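/- Let $K$ be an imaginary quadratic field with ring of integers $\mathcal O_K$, let $f$ and $N$ be positive integers, and let $\mathcal O=\mathbb Z+f\mathcal O_K$ be the order of conductor $f$ in $K$. For an order $R$ of $K$ and an integer $n\ge 1$: a fractional $R$-ideal $J$ is proper if $R=\{\alpha\in K:\alpha J\subseteq J\}$ (the proper fractional ideals are exactly the invertible ones, and form a group under multiplication); an ideal $I$ of $R$ is relatively prime to $n$ if $I+nR=R$; $\mathcal I(R,n)$ is the group generated by the proper ideals of $R$ relatively prime to $n$; $\mathcal P_0(R,n)\subseteq\mathcal I(R,n)$ is the subgroup generated by the nonzero principal ideals $\alpha R$ with $\alpha\in R$ and $\alpha\equiv a\pmod{nR}$ for some $a\in\mathbb Z$ with $\gcd(a,n)=1$; and $\mathcal C_0(R,n)=\mathcal I(R,n)/\mathcal P_0(R,n)$. Theorem. Every element of $\mathcal I(\mathcal O_K,Nf)$ has the form $\mathfrak a\mathfrak b^{-1}$ with $\mathfrak a,\mathfrak b$ nonzero ideals of $\mathcal O_K$ relatively prime to $Nf$. For all such $\mathfrak a,\mathfrak b$ the ideals $\mathfrak a\cap\mathcal O$ and $\mathfrak b\cap\mathcal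 O$ belong to $\mathcal I(\mathcal O,N)$, and $$\Psi:\mathcal C_0(\mathcal O_K,Nf)\longrightarrow\mathcal C_0(\mathcal O,N),\qquad [\mathfrak a\mathfrak b^{-1}]\longmapsto[(\mathfrak a\cap\mathcal O)(\mathfrak b\cap\mathcal O)^{-1}]$$ is a well-defined isomorphism of groups. Moreover $(\mathfrak a\cap\mathcal O)(\mathfrak b\cap\mathcal O)^{-1}\in\mathcal P_0(\mathcal O,N)$ if and only if $\mathfrak a\mathfrak b^{-1}\in\mathcal P_0(\mathcal O_K,Nf)$; that is, the induced homomorphism $\mathcal I(\mathcal O_K,Nf)\to\mathcal C_0(\mathcal O,N)$ has kernel $\mathcal P_0(\mathcal O_K,Nf)$. -/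

import Mathlib

open NumberField
open scoped nonZeroDivisors

namespace OrderClassGroup

section General

variable (R K : Type*) [CommRing R] [Field K] [Algebra R K]

/-- A fractional `R`-ideal `J` of `K` is proper if `R = {α ∈ K | α J ⊆ J}`. -/
def IsProper (J : FractionalIdeal R⁰ K) : Prop :=
  Set.range (algebraMap R K) = {α : K | ∀ x ∈ J, α * x ∈ J}

/-- An ideal `I` of `R` is relatively prime to `N` if `I + N R = R`. -/
def IsPrimeTo {R : Type*} [CommRing R] (N : ℕ) (I : Ideal R) : Prop :=
  I ⊔ Ideal.span {(N : R)} = ⊤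

/-- `I(R, N)`: the group generated by the proper ideals of `R` relatively prime to `N`, inside the
group of invertible fractional ideals. For orders of imaginary quadratic fields the latter is the
group of all proper fractional ideals: see `isProper_iff_isUnit` and
`isProper_iff_isUnit_ringOfIntegers` below. -/
def idealGroup (N : ℕ) : Subgroup (FractionalIdeal R⁰ K)ˣ :=
  Subgroup.closure {u | ∃ I : Ideal R, (u : FractionalIdeal R⁰ K) = (I : FractionalIdeal R⁰ K) ∧
    IsProper R K (I : FractionalIdeal R⁰ K) ∧ IsPrimeTo N I}

/-- `P₀(R, N)`: the group generated by the principal ideals `α R` with `α ∈ R` congruent modulo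
`N R` to a rational integer prime to `N`. -/
def principalGroup (N : ℕ) : Subgroup (FractionalIdeal R⁰ K)ˣ :=
  Subgroup.closure {u | ∃ (α : R) (a : ℤ), IsCoprime a (N : ℤ) ∧
    α - (a : R) ∈ Ideal.span {(N : R)} ∧
    (u : FractionalIdeal R⁰ K) = ((Ideal.span {α} : Ideal R) : FractionalIdeal R⁰ K)}

/-- `C₀(R, N) = I(R, N) / P₀(R, N)`; see `principalGroup_le_idealGroup`. -/
abbrev ClassGroup₀ (N : ℕ) : Type _ :=
  idealGroup R K N ⧸ (principalGroup R K N).subgroupOf (idealGroup R K N)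

variable {R K}

/-- Invertible fractional ideals are proper. -/
theorem isProper_of_isUnit {J : FractionalIdeal R⁰ K} (h : IsUnit J) : IsProper R K J := by
  obtain ⟨u, rfl⟩ := h
  ext α
  constructor
  · rintro ⟨r, rfl⟩ x hx
    rw [← Algebra.smul_def]
    exact Submodule.smul_mem (u : FractionalIdeal R⁰ K).coeToSubmodule r hx
  · intro h
    have key : ∀ z ∈ (u : FractionalIdeal R⁰ K) * (↑u⁻¹ : FractionalIdeal R⁰ K),
        α * z ∈ (u : FractionalIdeal R⁰ K) * (↑u⁻¹ : FractionalIdeal R⁰ K) := by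
      intro z hz
      refine FractionalIdeal.mul_induction_on hz (fun i hi j hj => ?_) (fun x y hx hy => ?_)
      · rw [← mul_assoc]
        exact FractionalIdeal.mul_mem_mul (h i hi) hj
      · rw [mul_add]
        exact Submodule.add_mem (FractionalIdeal.coeToSubmodule _) hx hy
    rw [Units.mul_inv] at key
    have := key 1 (FractionalIdeal.one_mem_one _)
    rw [mul_one, FractionalIdeal.mem_one_iff] at this
    exact this

/-- `P₀(R, N) ⊆ I(R, N)`. -/
theorem principalGroup_le_idealGroup (N : ℕ) : principalGroup R K N ≤ idealGroup R K N := by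
  refine (Subgroup.closure_le _).2 ?_
  rintro u ⟨α, a, ⟨s, t, hst⟩, hα, hu⟩
  refine Subgroup.subset_closure ⟨_, hu, isProper_of_isUnit (hu ▸ u.isUnit), ?_⟩
  obtain ⟨b, hb⟩ := Ideal.mem_span_singleton'.1 hα
  rw [IsPrimeTo, Ideal.eq_top_iff_one]
  have h1 : (s : R) * a + t * N = 1 := by exact_mod_cast congrArg (Int.cast : ℤ → R) hst
  have h2 : (1 : R) = s * α + (t - s * b) * N := by
    rw [← h1]; linear_combination (s : R) * hb
  rw [h2]
  exact Submodule.add_mem_sup (Ideal.mul_mem_left _ _ (Ideal.mem_span_singleton_self _))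
    (Ideal.mul_mem_left _ _ (Ideal.mem_span_singleton_self _))

end General

section Quadratic

variable (K : Type*) [Field K]

/-- `ℤ + f 𝓞_K`; in an imaginary quadratic field `K`, the order of conductor `f ≥ 1`. -/
def order (f : ℕ) : Subring K where
  carrier := {x | ∃ (n : ℤ) (y : 𝓞 K), x = n + f * (y : K)}
  mul_mem' := by
    rintro _ _ ⟨n, y, rfl⟩ ⟨m, z, rfl⟩
    exact ⟨n * m, (n : 𝓞 K) * z + (m : 𝓞 K) * y + f * y * z, by push_cast; simp; ring⟩
  one_mem' := ⟨1, 0, by simp⟩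
  add_mem' := by
    rintro _ _ ⟨n, y, rfl⟩ ⟨m, z, rfl⟩
    exact ⟨n + m, y + z, by push_cast; ring⟩
  zero_mem' := ⟨0, 0, by simp⟩
  neg_mem' := by
    rintro _ ⟨n, y, rfl⟩
    exact ⟨-n, -y, by push_cast; ring⟩

variable {K}

theorem isIntegral_of_mem_order {f : ℕ} {x : K} (hx : x ∈ order K f) : IsIntegral ℤ x := by
  obtain ⟨n, y, rfl⟩ := hx
  have h := ((n : 𝓞 K) + f * y).isIntegral_coe
  push_cast at h
  exact h

variable (K) in
/-- The inclusion of `ℤ + f 𝓞_K` in `𝓞_K`. -/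
def orderInclusion (f : ℕ) : order K f →+* 𝓞 K where
  toFun x := ⟨x, isIntegral_of_mem_order x.2⟩
  map_one' := rfl
  map_mul' _ _ := rfl
  map_zero' := rfl
  map_add' _ _ := rfl

/-- `𝔞 ∩ 𝓞` for an ideal `𝔞` of `𝓞_K` and the order `𝓞 = ℤ + f 𝓞_K`. -/
def contraction (f : ℕ) (𝔞 : Ideal (𝓞 K)) : Ideal (order K f) :=
  𝔞.comap (orderInclusion K f)

/-- The zero ideal is not proper. -/
theorem IsProper.ne_zero [CharZero K] {R : Type*} [CommRing R] [Algebra R K]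
    (hR : ∀ r : R, IsIntegral ℤ (algebraMap R K r))
    {J : FractionalIdeal R⁰ K} (h : IsProper R K J) : J ≠ 0 := by
  rintro rfl
  have h2 : (2⁻¹ : K) ∈ Set.range (algebraMap R K) := by
    rw [h]
    intro x hx
    rw [FractionalIdeal.mem_zero_iff] at hx
    simp [hx]
  obtain ⟨r, hr⟩ := h2
  have hi := hR r
  rw [hr, show (2⁻¹ : K) = algebraMap ℚ K 2⁻¹ by simp,
    isIntegral_algebraMap_iff (algebraMap ℚ K).injective, IsIntegrallyClosed.isIntegral_iff] at hi
  obtain ⟨n, hn⟩ := hi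
  have : (2 * n : ℚ) = 1 := by
    rw [show (n : ℚ) = 2⁻¹ from hn]; norm_num
  have : 2 * n = 1 := by exact_mod_cast this
  omega

/-- Fractional ideals of `𝓞_K` are proper if and only if they are invertible. -/
theorem isProper_iff_isUnit_ringOfIntegers [NumberField K] {J : FractionalIdeal (𝓞 K)⁰ K} :
    IsProper (𝓞 K) K J ↔ IsUnit J :=
  ⟨fun h => isUnit_iff_ne_zero.2 (h.ne_zero fun r => r.isIntegral_coe), isProper_of_isUnit⟩

theorem exists_span_pair [NumberField K] (hK : Module.finrank ℚ K = 2) (f : ℕ)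
    (J : FractionalIdeal (order K f)⁰ K) :
    ∃ x y : K, ∀ z : K, z ∈ J ↔ ∃ m n : ℤ, z = m * x + n * y := by
  obtain ⟨a, ha, haJ⟩ := J.isFractional
  have ha0 : (a : K) ≠ 0 := fun h => nonZeroDivisors.ne_zero ha (Subtype.ext h)
  let S : Submodule ℤ K := (J : Submodule (order K f) K).restrictScalars ℤ
  let φ : S →ₗ[ℤ] 𝓞 K :=
    { toFun := fun z => ⟨(a : K) * z, by
        obtain ⟨r, hr⟩ := haJ z z.2
        rw [Algebra.smul_def] at hr
        have h2 : IsIntegral ℤ ((r : order K f) : K) := isIntegral_of_mem_order r.2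
        exact (show ((r : order K f) : K) = a * z from hr) ▸ h2⟩
      map_add' := fun z w => RingOfIntegers.ext (mul_add (a : K) z w)
      map_smul' := fun n z => RingOfIntegers.ext (mul_smul_comm n (a : K) (z : K)) }
  have hφ : Function.Injective φ := by
    intro z w h
    have h2 : (a : K) * z = a * w := congrArg (fun t : 𝓞 K => (t : K)) h
    exact Subtype.ext (mul_left_cancel₀ ha0 h2)
  have : Module.Finite ℤ S := Module.Finite.of_injective φ hφ
  have : Module.Free ℤ S := Module.free_of_finite_type_torsion_free'
  obtain ⟨n, b⟩ : Σ n : ℕ, Module.Basis (Fin n) ℤ S := ⟨_, Module.finBasis ℤ S⟩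
  have hli : LinearIndependent ℤ (fun i => (b i : K)) :=
    b.linearIndependent.map' S.subtype (Submodule.ker_subtype S)
  rw [LinearIndependent.iff_fractionRing ℤ ℚ] at hli
  have hcard := hli.fintype_card_le_finrank
  rw [hK, Fintype.card_fin] at hcard
  have hmem : ∀ z : K, z ∈ J ↔ ∃ c : Fin n → ℤ, z = ∑ i, c i * (b i : K) := by
    intro z
    constructor
    · intro hz
      refine ⟨b.repr (⟨z, hz⟩ : S), ?_⟩
      have := congrArg S.subtype (b.sum_repr (⟨z, hz⟩ : S))
      rw [map_sum] at this
      simp only [map_smul, zsmul_eq_mul] at this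
      exact this.symm
    · rintro ⟨c, rfl⟩
      have : S.subtype (∑ i, c i • b i) ∈ S := Subtype.mem _
      rw [map_sum] at this
      simp only [map_smul, zsmul_eq_mul] at this
      exact this
  interval_cases n
  · refine ⟨0, 0, fun z => ?_⟩
    simp [hmem]
  · refine ⟨b 0, 0, fun z => ?_⟩
    rw [hmem]
    constructor
    · rintro ⟨c, rfl⟩
      exact ⟨c 0, 0, by simp⟩
    · rintro ⟨m, k, rfl⟩
      exact ⟨fun _ => m, by simp⟩
  · refine ⟨b 0, b 1, fun z => ?_⟩
    rw [hmem]
    constructor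
    · rintro ⟨c, rfl⟩
      exact ⟨c 0, c 1, by simp [Fin.sum_univ_two]⟩
    · rintro ⟨m, k, rfl⟩
      exact ⟨![m, k], by simp [Fin.sum_univ_two]⟩

theorem exists_conj [NumberField K] (hK : Module.finrank ℚ K = 2) :
    ∃ σ : K ≃ₐ[ℚ] K, (∀ x, σ (σ x) = x) ∧ (∀ x, ∃ q : ℚ, x * σ x = q) ∧
      ∀ x, ∃ q : ℚ, x + σ x = q := by
  have : Algebra.IsQuadraticExtension ℚ K := ⟨hK⟩
  have hcard : Nat.card (K ≃ₐ[ℚ] K) = 2 := by rw [IsGalois.card_aut_eq_finrank, hK]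
  obtain ⟨σ, hσ, hu⟩ := (Nat.card_eq_two_iff' (1 : K ≃ₐ[ℚ] K)).1 hcard
  have hall : ∀ τ : K ≃ₐ[ℚ] K, τ = 1 ∨ τ = σ := fun τ => by
    by_cases h : τ = 1
    · exact Or.inl h
    · exact Or.inr (hu τ h)
  have hσσ : ∀ x, σ (σ x) = x := by
    intro x
    rcases hall (σ * σ) with h | h
    · exact DFunLike.congr_fun h x
    · exact absurd (mul_eq_left.1 h) hσ
  have hfix : ∀ x, σ x = x → ∃ q : ℚ, x = q := by
    intro x hx
    have : x ∈ (⊥ : IntermediateField ℚ K) := by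
      rw [IsGalois.mem_bot_iff_fixed]
      intro τ
      rcases hall τ with rfl | rfl
      · rfl
      · exact hx
    obtain ⟨q, hq⟩ := IntermediateField.mem_bot.1 this
    exact ⟨q, by rw [← hq]; simp⟩
  exact ⟨σ, hσσ, fun x => hfix _ (by rw [map_mul, hσσ, mul_comm]),
    fun x => hfix _ (by rw [map_add, hσσ, add_comm])⟩

theorem exists_gcd_rat (p q : ℚ) :
    ∃ (c : ℚ) (m n k l : ℤ), p = m * c ∧ q = n * c ∧ c = k * p + l * q := by
  have hp : (p.den : ℚ) ≠ 0 := by exact_mod_cast p.den_nz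
  have hq : (q.den : ℚ) ≠ 0 := by exact_mod_cast q.den_nz
  let A : ℤ := p.num * q.den
  let B : ℤ := q.num * p.den
  obtain ⟨m, hm⟩ := Int.gcd_dvd_left A B
  obtain ⟨n, hn⟩ := Int.gcd_dvd_right A B
  have hg := Int.gcd_eq_gcd_ab A B
  have hpA : p = (A : ℚ) / (p.den * q.den) := by
    simp only [A]; push_cast; field_simp; first | done | exact (Rat.mul_den_eq_num p)
  have hqB : q = (B : ℚ) / (p.den * q.den) := by
    simp only [B]; push_cast; field_simp; first | done | exact (Rat.mul_den_eq_num q)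
  have hm' : (A : ℚ) = (Int.gcd A B : ℤ) * m := by exact_mod_cast hm
  have hn' : (B : ℚ) = (Int.gcd A B : ℤ) * n := by exact_mod_cast hn
  have hg' : ((Int.gcd A B : ℤ) : ℚ) = A * Int.gcdA A B + B * Int.gcdB A B := by
    exact_mod_cast hg
  generalize (p.den * q.den : ℚ) = D at hpA hqB
  refine ⟨((Int.gcd A B : ℤ) : ℚ) / D, m, n, Int.gcdA A B, Int.gcdB A B, ?_, ?_, ?_⟩
  · rw [hpA, hm']; ring
  · rw [hqB, hn']; ring
  · rw [hg', hpA, hqB]; ring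

/-- Fractional ideals of an order of a quadratic field are proper if and only if they are
invertible, so that the proper ones form a group. -/
theorem isProper_iff_isUnit [NumberField K] (hK : Module.finrank ℚ K = 2) {f : ℕ}
    {J : FractionalIdeal (order K f)⁰ K} : IsProper (order K f) K J ↔ IsUnit J := by
  refine ⟨fun h => ?_, isProper_of_isUnit⟩
  have hJ0 : J ≠ 0 := h.ne_zero fun r => isIntegral_of_mem_order r.2
  have hmul : ∀ β : K, (∀ z ∈ J, β * z ∈ J) → β ∈ order K f := by
    intro β hβ
    obtain ⟨r, hr⟩ : β ∈ Set.range (algebraMap (order K f) K) := by rw [h]; exact hβ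
    exact hr ▸ r.2
  obtain ⟨x, y, hxy⟩ := exists_span_pair hK f J
  obtain ⟨σ, hσσ, hN, hT⟩ := exists_conj hK
  have hσO : ∀ r ∈ order K f, σ r ∈ order K f := by
    rintro _ ⟨n, w, rfl⟩
    refine ⟨n, ⟨σ w, w.isIntegral_coe.map (σ.toAlgHom.restrictScalars ℤ)⟩, ?_⟩
    simp only [map_add, map_mul, map_intCast, map_natCast]
    rfl
  obtain ⟨q₁, h₁⟩ := hN x
  obtain ⟨q₂, h₂⟩ := hN y
  obtain ⟨q₃, h₃⟩ := hT (x * σ y)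
  rw [map_mul, hσσ] at h₃
  obtain ⟨d, m₁, m₂, k₁, k₂, e₁, e₂, e₃⟩ := exists_gcd_rat q₁ q₂
  obtain ⟨c, m, m₃, k, k₃, g₁, g₂, g₃⟩ := exists_gcd_rat d q₃
  have hc0 : c ≠ 0 := by
    rintro rfl
    have hd : d = 0 := by rw [g₁, mul_zero]
    have hx : x = 0 := by simpa [e₁, hd] using h₁
    have hy : y = 0 := by simpa [e₂, hd] using h₂
    refine hJ0 (FractionalIdeal.eq_zero_iff.2 fun z hz => ?_)
    obtain ⟨s, t, rfl⟩ := (hxy z).1 hz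
    simp [hx, hy]
  have hcK : (c : K) ≠ 0 := by exact_mod_cast hc0
  have H₁ : x * σ x = m₁ * m * c := by rw [h₁, e₁, g₁]; push_cast; ring
  have H₂ : y * σ y = m₂ * m * c := by rw [h₂, e₂, g₁]; push_cast; ring
  have H₃ : x * σ y + σ x * y = m₃ * c := by rw [h₃, g₂]; push_cast; ring
  have Hc : (c : K) = k * k₁ * (x * σ x) + k * k₂ * (y * σ y) + k₃ * (x * σ y + σ x * y) := by
    rw [h₁, h₂, h₃]
    exact_mod_cast (show c = k * k₁ * q₁ + k * k₂ * q₂ + k₃ * q₃ by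
      rw [g₃, e₃]; ring)
  have hint : ∀ n : ℤ, (n : K) ∈ order K f := fun n => intCast_mem _ n
  have b₁ : x * σ y / c ∈ order K f := by
    refine hmul _ fun z hz => ?_
    obtain ⟨s, t, rfl⟩ := (hxy z).1 hz
    refine (hxy _).2 ⟨s * m₃ + t * (m₂ * m), -(s * (m₁ * m)), ?_⟩
    push_cast
    field_simp
    linear_combination (s : K) * x * H₃ + (t : K) * x * H₂ - (s : K) * y * H₁
  have b₂ : σ x * y / c ∈ order K f := by
    have := sub_mem (hint m₃) b₁
    convert this using 1
    field_simp
    linear_combination H₃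
  let J' : FractionalIdeal (order K f)⁰ K := ⟨
    { carrier := {z | c * σ z ∈ J}
      add_mem' := fun {z w} hz hw => by
        have := Submodule.add_mem (J : Submodule (order K f) K) hz hw
        simpa [mul_add] using this
      zero_mem' := by simpa using J.zero_mem
      smul_mem' := fun r z hz => by
        have := Submodule.smul_mem (J : Submodule (order K f) K) ⟨σ r, hσO _ r.2⟩ hz
        have e : c * σ (r • z) = (⟨σ r, hσO _ r.2⟩ : order K f) • (c * σ z) := by
          simp only [Algebra.smul_def, map_mul]
          change c * (σ (r : K) * σ z) = σ (r : K) * (c * σ z)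
          ring
        change c * σ (r • z) ∈ J
        rw [e]
        exact this }, by
    obtain ⟨a, ha, haJ⟩ := J.isFractional
    have ha0 : (a : K) ≠ 0 := fun h => nonZeroDivisors.ne_zero ha (Subtype.ext h)
    have hcn : (c.num : K) ≠ 0 := by exact_mod_cast (Rat.num_ne_zero.2 hc0)
    refine ⟨⟨σ a * c.num, mul_mem (hσO _ a.2) (hint _)⟩, mem_nonZeroDivisors_of_ne_zero ?_, ?_⟩
    · intro h0
      have := congrArg Subtype.val h0
      simp [ha0, hcn] at this
    · intro z hz
      obtain ⟨r, hr⟩ := haJ _ hz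
      refine ⟨⟨σ r * c.den, mul_mem (hσO _ r.2) (natCast_mem _ _)⟩, ?_⟩
      have hr' : (r : K) = a * (c * σ z) := hr
      change σ r * c.den = (σ a * c.num) * z
      rw [hr']
      have hcc : (c : K) * c.den = c.num := by exact_mod_cast (Rat.mul_den_eq_num c)
      simp only [map_mul, hσσ, map_ratCast]
      rw [← hcc]; ring⟩
  have hJ' : ∀ z : K, z ∈ J' ↔ c * σ z ∈ J := fun z => Iff.rfl
  have hx' : σ x / c ∈ J' := by
    rw [hJ']
    refine (hxy _).2 ⟨1, 0, ?_⟩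
    simp only [map_div₀, hσσ, map_ratCast]
    field_simp
    simp
  have hy' : σ y / c ∈ J' := by
    rw [hJ']
    refine (hxy _).2 ⟨0, 1, ?_⟩
    simp only [map_div₀, hσσ, map_ratCast]
    field_simp
    simp
  have hx : x ∈ J := (hxy _).2 ⟨1, 0, by simp⟩
  have hy : y ∈ J := (hxy _).2 ⟨0, 1, by simp⟩
  refine IsUnit.of_mul_eq_one J' (le_antisymm (FractionalIdeal.mul_le.2 ?_) ?_)
  · intro i hi z hz
    obtain ⟨s, t, rfl⟩ := (hxy _).1 hi
    obtain ⟨s', t', hz'⟩ := (hxy _).1 ((hJ' z).1 hz)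
    have hz2 : z = (s' * σ x + t' * σ y) / c := by
      have := congrArg σ hz'
      simp only [map_mul, map_add, hσσ, map_ratCast, map_intCast] at this
      rw [← this]; field_simp
    rw [FractionalIdeal.mem_one_iff]
    have hm : (s * x + t * y) * z ∈ order K f := by
      have e : (s * x + t * y) * z = ((s * s' * (m₁ * m) + t * t' * (m₂ * m) : ℤ) : K)
          + ((s * t' : ℤ) : K) * (x * σ y / c) + ((t * s' : ℤ) : K) * (σ x * y / c) := by
        rw [hz2]
        push_cast
        field_simp
        linear_combination (s : K) * s' * H₁ + (t : K) * t' * H₂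
      rw [e]
      exact add_mem (add_mem (hint _) (mul_mem (hint _) b₁)) (mul_mem (hint _) b₂)
    exact ⟨⟨_, hm⟩, rfl⟩
  · rw [FractionalIdeal.one_le]
    have hS : ∀ (n : ℤ) {u v : K}, u ∈ J → v ∈ J' → (n : K) * (u * v) ∈ J * J' := by
      intro n u v hu hv
      have := Submodule.smul_mem (J * J' : FractionalIdeal (order K f)⁰ K).coeToSubmodule
        (⟨n, hint n⟩ : order K f) (FractionalIdeal.mul_mem_mul hu hv)
      exact this
    have e : (1 : K) = ((k * k₁ : ℤ) : K) * (x * (σ x / c)) + ((k * k₂ : ℤ) : K) * (y * (σ y / c))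
        + (k₃ : K) * (x * (σ y / c)) + (k₃ : K) * (y * (σ x / c)) := by
      push_cast
      field_simp
      linear_combination Hc
    rw [e]
    have hA : ∀ {u v : K}, u ∈ J * J' → v ∈ J * J' → u + v ∈ J * J' := fun hu hv =>
      Submodule.add_mem (J * J' : FractionalIdeal (order K f)⁰ K).coeToSubmodule hu hv
    exact hA (hA (hA (hS _ hx hx') (hS _ hy hy')) (hS _ hx hy')) (hS _ hy hx')

end Quadratic

end OrderClassGroup

open NumberField
open scoped nonZeroDivisors

namespace OrderClassGroup

/-! Write O for `order K f`. Everything goes through the extension map J ↦ J O_K, the inverse of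
contraction on ideals prime to f. Since f O_K ⊆ O, an ideal of either ring that is prime to f is
recovered from its image in the other (`map_contraction`, `contraction_map`). Hence extension maps
I(O, Nf) isomorphically onto I(O_K, Nf) (`extension_injOn`,
`exists_extension_eq_of_mem_idealGroup`).

Under this isomorphism P₀(O_K, Nf) corresponds to I(O, Nf) ∩ P₀(O, N)
(`extension_mem_principalGroup_iff`). The source of this is arithmetic: an element of O_K congruent
to an integer modulo Nf O_K is the same as an element of O congruent to an integer modulo N O,
because N O = Nℤ + Nf O_K.

Finally I(O, N) is generated by I(O, Nf) and P₀(O, N) (`idealGroup_le_sup`): each class contains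
ideals prime to f as well. The second isomorphism theorem then identifies I(O, Nf) / (I(O, Nf) ∩
P₀(O, N)) with C₀(O, N). -/

theorem exists_mul_inv_of_mem_closure {G : Type*} [CommGroup G] {S : Set G} (h1 : 1 ∈ S)
    (hmul : ∀ a ∈ S, ∀ b ∈ S, a * b ∈ S) {x : G} (hx : x ∈ Subgroup.closure S) :
    ∃ a ∈ S, ∃ b ∈ S, x = a * b⁻¹ := by
  induction hx using Subgroup.closure_induction with
  | mem x hx => exact ⟨x, hx, 1, h1, by simp⟩
  | one => exact ⟨1, h1, 1, h1, by simp⟩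
  | mul x y _ _ hx hy =>
    obtain ⟨a, ha, b, hb, rfl⟩ := hx
    obtain ⟨c, hc, d, hd, rfl⟩ := hy
    exact ⟨a * c, hmul a ha c hc, b * d, hmul b hb d hd, by rw [mul_inv]; exact mul_mul_mul_comm ..⟩
  | inv x _ hx =>
    obtain ⟨a, ha, b, hb, rfl⟩ := hx
    exact ⟨b, hb, a, ha, by simp⟩

/-! ### Ideals prime to n, and invertible integral ideals. -/

section General

variable {R K : Type*} [CommRing R] [Field K] [Algebra R K]

theorem isPrimeTo_iff {n : ℕ} {I : Ideal R} :
    IsPrimeTo n I ↔ ∃ x ∈ I, x - 1 ∈ Ideal.span {(n : R)} := by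
  rw [IsPrimeTo, Ideal.eq_top_iff_one, Submodule.mem_sup]
  constructor
  · rintro ⟨x, hx, y, hy, h⟩
    refine ⟨x, hx, ?_⟩
    rw [← h, sub_add_cancel_left]
    exact neg_mem hy
  · rintro ⟨x, hx, h⟩
    exact ⟨x, hx, 1 - x, by rw [← neg_sub]; exact neg_mem h, by ring⟩

theorem IsPrimeTo.mul {n : ℕ} {I J : Ideal R} (hI : IsPrimeTo n I) (hJ : IsPrimeTo n J) :
    IsPrimeTo n (I * J) := by
  unfold IsPrimeTo at *
  rw [← Ideal.isCoprime_iff_sup_eq] at *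
  exact hI.mul_left hJ

theorem IsPrimeTo.mono {n : ℕ} {I J : Ideal R} (hI : IsPrimeTo n I) (h : I ≤ J) :
    IsPrimeTo n J :=
  eq_top_mono (sup_le_sup_right h _) hI

theorem IsPrimeTo.of_dvd {m n : ℕ} {I : Ideal R} (hI : IsPrimeTo n I) (h : m ∣ n) :
    IsPrimeTo m I := by
  refine eq_top_mono (sup_le_sup_left ?_ _) hI
  exact Ideal.span_singleton_le_span_singleton.2 (by exact_mod_cast Nat.cast_dvd_cast h)

theorem isPrimeTo_top (n : ℕ) : IsPrimeTo n (⊤ : Ideal R) := top_sup_eq _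

/-- A nonzero ideal prime to `n` contains a nonzero element congruent to `1` modulo `n`. -/
theorem IsPrimeTo.exists_ne_zero {n : ℕ} {I : Ideal R} (hI : IsPrimeTo n I) (h0 : I ≠ ⊥) :
    ∃ x ∈ I, x ≠ 0 ∧ x - 1 ∈ Ideal.span {(n : R)} := by
  obtain ⟨x, hx, hxn⟩ := isPrimeTo_iff.1 hI
  -- If x = 0, then 1 lies in n R, so the congruence is vacuous and any nonzero element of I will
  -- do.
  by_cases hx0 : x = 0
  · obtain ⟨y, hy, hy0⟩ := Submodule.exists_mem_ne_zero_of_ne_bot h0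
    refine ⟨y, hy, hy0, ?_⟩
    have : Ideal.span {(n : R)} = ⊤ := by
      rw [Ideal.eq_top_iff_one]
      simpa [hx0] using neg_mem hxn
    simp [this]
  · exact ⟨x, hx, hx0, hxn⟩

theorem mem_idealGroup {n : ℕ} {u : (FractionalIdeal R⁰ K)ˣ} {I : Ideal R}
    (hu : (u : FractionalIdeal R⁰ K) = I) (hI : IsPrimeTo n I) : u ∈ idealGroup R K n :=
  Subgroup.subset_closure ⟨I, hu, hu ▸ isProper_of_isUnit u.isUnit, hI⟩

/-- Every element of `I(R, n)` is a quotient of two integral ideals prime to `n`. -/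
theorem exists_mul_inv_of_mem_idealGroup {n : ℕ} {u : (FractionalIdeal R⁰ K)ˣ}
    (hu : u ∈ idealGroup R K n) :
    ∃ (I J : Ideal R) (U V : (FractionalIdeal R⁰ K)ˣ), IsPrimeTo n I ∧ IsPrimeTo n J ∧
      (U : FractionalIdeal R⁰ K) = I ∧ (V : FractionalIdeal R⁰ K) = J ∧ u = U * V⁻¹ := by
  obtain ⟨U, ⟨I, hU, -, hI⟩, V, ⟨J, hV, -, hJ⟩, h⟩ := exists_mul_inv_of_mem_closure
    (by exact ⟨⊤, by simp, isProper_of_isUnit (by simp), isPrimeTo_top n⟩) (by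
      rintro a ⟨I, hI, -, hI'⟩ b ⟨J, hJ, -, hJ'⟩
      have h : ((a * b : (FractionalIdeal R⁰ K)ˣ) : FractionalIdeal R⁰ K) = (I * J : Ideal R) := by
        rw [Units.val_mul, hI, hJ, FractionalIdeal.coeIdeal_mul]
      exact ⟨I * J, h, h ▸ isProper_of_isUnit (Units.isUnit _), hI'.mul hJ'⟩) hu
  exact ⟨I, J, U, V, hI, hJ, hU, hV, h⟩

/-- Every element of `P₀(R, n)` is a quotient of two principal ideals generated by elements
congruent to integers prime to `n`. -/
theorem exists_mul_inv_of_mem_principalGroup {n : ℕ} {u : (FractionalIdeal R⁰ K)ˣ}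
    (hu : u ∈ principalGroup R K n) :
    ∃ (α β : R) (a b : ℤ) (U V : (FractionalIdeal R⁰ K)ˣ),
      IsCoprime b (n : ℤ) ∧
      α - (a : R) ∈ Ideal.span {(n : R)} ∧ β - (b : R) ∈ Ideal.span {(n : R)} ∧
      (U : FractionalIdeal R⁰ K) = (Ideal.span {α} : Ideal R) ∧
      (V : FractionalIdeal R⁰ K) = (Ideal.span {β} : Ideal R) ∧ u = U * V⁻¹ := by
  obtain ⟨U, ⟨α, a, ha, hα, hU⟩, V, ⟨β, b, hb, hβ, hV⟩, h⟩ := exists_mul_inv_of_mem_closure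
    (by exact ⟨1, 1, isCoprime_one_left, by simp, by simp [Ideal.span_singleton_one]⟩) (by
      rintro U ⟨α, a, ha, hα, hU⟩ V ⟨β, b, hb, hβ, hV⟩
      refine ⟨α * β, a * b, ha.mul_left hb, ?_, ?_⟩
      · have : α * β - ((a * b : ℤ) : R) = β * (α - a) + a * (β - b) := by push_cast; ring
        rw [this]
        exact add_mem (Ideal.mul_mem_left _ _ hα) (Ideal.mul_mem_left _ _ hβ)
      · rw [Units.val_mul, hU, hV, ← FractionalIdeal.coeIdeal_mul,
          Ideal.span_singleton_mul_span_singleton]) hu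
  exact ⟨α, β, a, b, U, V, hb, hα, hβ, hU, hV, h⟩

theorem coe_ne_bot {u : (FractionalIdeal R⁰ K)ˣ} {I : Ideal R}
    (hu : (u : FractionalIdeal R⁰ K) = I) : I ≠ ⊥ := by
  rintro rfl
  exact u.ne_zero (by simp [hu])

variable [IsFractionRing R K]

variable (K) in
theorem exists_unit_span {x : R} (hx : x ≠ 0) :
    ∃ u : (FractionalIdeal R⁰ K)ˣ, (u : FractionalIdeal R⁰ K) = (Ideal.span {x} : Ideal R) := by
  have h : algebraMap R K x ≠ 0 := by
    rwa [Ne, FaithfulSMul.algebraMap_eq_zero_iff]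
  exact ⟨Units.mkOfMulEqOne (Ideal.span {x} : Ideal R)
    (FractionalIdeal.spanSingleton R⁰ (algebraMap R K x)⁻¹) (by
    rw [FractionalIdeal.coeIdeal_span_singleton, FractionalIdeal.spanSingleton_mul_spanSingleton,
      mul_inv_cancel₀ h, FractionalIdeal.spanSingleton_one]), rfl⟩

/-- Integral invertible ideals divide the elements that they contain. -/
theorem exists_mul_eq_span {u : (FractionalIdeal R⁰ K)ˣ} {I : Ideal R}
    (hu : (u : FractionalIdeal R⁰ K) = I) {x : R} (hx : x ∈ I) :
    ∃ J : Ideal R, I * J = Ideal.span {x} := by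
  have h : (Ideal.span {x} : Ideal R) * (↑u⁻¹ : FractionalIdeal R⁰ K) ≤ 1 := by
    rw [← u.mul_inv, hu]
    gcongr
    exact (Ideal.span_singleton_le_iff_mem _).2 hx
  obtain ⟨J, hJ⟩ := FractionalIdeal.le_one_iff_exists_coeIdeal.1 h
  refine ⟨J, FractionalIdeal.coeIdeal_injective (K := K) ?_⟩
  change ((I * J : Ideal R) : FractionalIdeal R⁰ K) = (Ideal.span {x} : Ideal R)
  rw [FractionalIdeal.coeIdeal_mul, hJ, ← hu, mul_left_comm, u.mul_inv, mul_one]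

theorem exists_unit_of_mul_eq_span {I J : Ideal R} {x : R} (h : I * J = Ideal.span {x})
    (hx : x ≠ 0) : ∃ u : (FractionalIdeal R⁰ K)ˣ, (u : FractionalIdeal R⁰ K) = I := by
  obtain ⟨v, hv⟩ := exists_unit_span K hx
  have : IsUnit ((I : FractionalIdeal R⁰ K) * J) := by
    rw [← FractionalIdeal.coeIdeal_mul, h, ← hv]
    exact v.isUnit
  obtain ⟨u, hu⟩ := isUnit_of_mul_isUnit_left this
  exact ⟨u, hu⟩

end General

/-! ### Moving an invertible ideal away from finitely many primes. -/

/-- A Chinese remainder theorem for the quotients `I ⧸ Q I`. -/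
theorem exists_forall_sub_mem_mul {R : Type*} [CommRing R] (I : Ideal R) {s : Finset (Ideal R)}
    (hs : ∀ P ∈ s, ∀ Q ∈ s, P ≠ Q → IsCoprime P Q) (x : Ideal R → R) (hx : ∀ Q, x Q ∈ I) :
    ∃ α ∈ I, ∀ Q ∈ s, α - x Q ∈ Q * I := by
  classical
  -- r P is the Chinese remainder indicator of P: it is 1 modulo P and 0 modulo the other members of
  -- s.
  have hr : ∀ P : Ideal R, ∃ r : R, ∀ Q ∈ s, r - (if Q = P then 1 else 0) ∈ Q := fun P => by
    obtain ⟨r, hr⟩ := Ideal.exists_forall_sub_mem_ideal (I := fun Q : s => (Q : Ideal R))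
      (fun P Q h => hs P P.2 Q Q.2 (Subtype.coe_injective.ne h))
      (fun Q => if (Q : Ideal R) = P then (1 : R) else 0)
    exact ⟨r, fun Q hQ => hr ⟨Q, hQ⟩⟩
  choose r hr using hr
  refine ⟨∑ P ∈ s, r P * x P, sum_mem fun P _ => I.mul_mem_left _ (hx P), fun Q hQ => ?_⟩
  have : ∑ P ∈ s, r P * x P - x Q = ∑ P ∈ s, (r P - if Q = P then 1 else 0) * x P := by
    simp [sub_mul, Finset.sum_sub_distrib, hQ]
  rw [this]
  exact sum_mem fun P _ => Ideal.mul_mem_mul (hr P Q hQ) (hx P)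

/-- An invertible ideal `I` prime to `N` divides a principal ideal `α R` with `α ≡ 1` modulo `N`
and cofactor prime to `N F`. -/
theorem exists_mul_eq_span_isPrimeTo {R K : Type*} [CommRing R] [IsDomain R] [CharZero R]
    [Field K] [Algebra R K] [IsFractionRing R K] {N F : ℕ} (hN : 0 < N) (hF : 0 < F)
    (hfin : {P : Ideal R | P.IsMaximal ∧ (F : R) ∈ P}.Finite)
    {u : (FractionalIdeal R⁰ K)ˣ} {I : Ideal R} (hu : (u : FractionalIdeal R⁰ K) = I)
    (hI : IsPrimeTo N I) :
    ∃ (α : R) (J : Ideal R), α ≠ 0 ∧ α - 1 ∈ Ideal.span {(N : R)} ∧ I * J = Ideal.span {α} ∧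
      IsPrimeTo (N * F) J := by
  classical
  obtain ⟨e, he, heN⟩ := isPrimeTo_iff.1 hI
  have hfin' : {P : Ideal R | P.IsMaximal ∧ (F : R) ∈ P ∧ (N : R) ∉ P}.Finite :=
    hfin.subset fun P hP => ⟨hP.1, hP.2.1⟩
  -- P I ≠ I for maximal P, since I can be cancelled. The cofactor α I⁻¹ is not contained in P as
  -- soon as α ∉ P I.
  have hlt : ∀ P : Ideal R, ∃ x ∈ I, P.IsMaximal → x ∉ P * I := by
    intro P
    by_cases hP : P.IsMaximal
    · by_contra! h
      have h1 : P * I = I := le_antisymm Ideal.mul_le_right fun x hx => (h x hx).2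
      refine hP.ne_top (FractionalIdeal.coeIdeal_injective (K := K) ?_)
      have h2 := congrArg (fun J : Ideal R => (J : FractionalIdeal R⁰ K)) h1
      simp only [FractionalIdeal.coeIdeal_mul, ← hu] at h2
      simpa using u.mul_left_inj.1 (h2.trans (one_mul _).symm)
    · exact ⟨0, I.zero_mem, fun h => absurd h hP⟩
  choose x hxI hx using hlt
  have hNs : Ideal.span {(N : R)} ∉ hfin'.toFinset := fun h =>
    (hfin'.mem_toFinset.1 h).2.2 (Ideal.mem_span_singleton_self _)
  have hcop : ∀ P ∈ hfin'.toFinset, IsCoprime P (Ideal.span {(N : R)}) := by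
    intro P hP
    obtain ⟨hP, -, hNP⟩ := hfin'.mem_toFinset.1 hP
    rw [Ideal.isCoprime_iff_sup_eq]
    exact hP.1.2 _ (left_lt_sup.2 fun h => hNP ((Ideal.span_singleton_le_iff_mem _).1 h))
  -- Only the maximal ideals containing F but not N need a local condition; those containing N are
  -- handled by the congruence α ≡ 1.
  obtain ⟨β, hβI, hβ⟩ := exists_forall_sub_mem_mul I
    (s := insert (Ideal.span {(N : R)}) hfin'.toFinset)
    (by
      intro P hP Q hQ h
      rcases Finset.mem_insert.1 hP with rfl | hP' <;> rcases Finset.mem_insert.1 hQ with rfl | hQ'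
      · exact absurd rfl h
      · exact (hcop Q hQ').symm
      · exact hcop P hP'
      · rw [Ideal.isCoprime_iff_sup_eq]
        exact Ideal.IsMaximal.coprime_of_ne (hfin'.mem_toFinset.1 hP').1
          (hfin'.mem_toFinset.1 hQ').1 h)
    (fun Q => if Q = Ideal.span {(N : R)} then e else x Q)
    (fun Q => by split_ifs; exacts [he, hxI Q])
  have hβN : β - 1 ∈ Ideal.span {(N : R)} := by
    have := hβ _ (Finset.mem_insert_self _ _)
    rw [if_pos rfl] at this
    simpa using add_mem (Ideal.mul_le_left this) heN
  have hβP : ∀ P : Ideal R, P.IsMaximal → (F : R) ∈ P → (N : R) ∉ P → β ∉ P * I := by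
    intro P h1 h2 h3 h
    have hP := hfin'.mem_toFinset.2 ⟨h1, h2, h3⟩
    have := hβ P (Finset.mem_insert_of_mem hP)
    rw [if_neg (fun h : P = Ideal.span {(N : R)} => hNs (h ▸ hP))] at this
    exact hx P h1 (by simpa using sub_mem h this)
  obtain ⟨α, hα0, hαI, hαN, hαP⟩ : ∃ α, α ≠ 0 ∧ α ∈ I ∧ α - 1 ∈ Ideal.span {(N : R)} ∧
      ∀ P : Ideal R, P.IsMaximal → (F : R) ∈ P → (N : R) ∉ P → α ∉ P * I := by
    -- β = 0 can occur only if N R = R and there is no P to avoid, as 0 ∈ P I; then a nonzero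
    -- multiple of N F in I serves.
    by_cases h0 : β = 0
    · obtain ⟨y, hy, hy0⟩ := Submodule.exists_mem_ne_zero_of_ne_bot (coe_ne_bot hu)
      refine ⟨N * (F * y), ?_, I.mul_mem_left _ (I.mul_mem_left _ hy), ?_, ?_⟩
      · have : (N : R) ≠ 0 := by exact_mod_cast hN.ne'
        have : (F : R) ≠ 0 := by exact_mod_cast hF.ne'
        simp [*]
      · rw [h0] at hβN
        have := add_mem hβN (Ideal.mul_mem_right (F * y) _ (Ideal.mem_span_singleton_self (N : R)))
        convert this using 1
        ring
      · intro P h1 h2 h3 _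
        exact hβP P h1 h2 h3 (h0 ▸ zero_mem _)
    · exact ⟨β, h0, hβI, hβN, hβP⟩
  obtain ⟨J, hJ⟩ := exists_mul_eq_span hu hαI
  refine ⟨α, J, hα0, hαN, hJ, ?_⟩
  have hαJ : α ∈ J := Ideal.mul_le_right (hJ ▸ Ideal.mem_span_singleton_self α)
  by_contra hcon
  obtain ⟨P, hP, hle⟩ := Ideal.exists_le_maximal _ hcon
  have hJP : J ≤ P := le_sup_left.trans hle
  have hNF : (N : R) * F ∈ P := by
    have := hle (Ideal.mem_sup_right (Ideal.mem_span_singleton_self _))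
    simpa using this
  -- If N ∈ P, then α ∈ J ⊆ P and α ≡ 1 modulo N put 1 in P. Otherwise F ∈ P, and α ∈ I J ⊆ P I
  -- contradicts the choice of α.
  by_cases hNP : (N : R) ∈ P
  · refine hP.ne_top ((Ideal.eq_top_iff_one _).2 ?_)
    have := sub_mem (hJP hαJ) ((Ideal.span_singleton_le_iff_mem _).2 hNP hαN)
    simpa using this
  · refine hαP P hP ((hP.isPrime.mem_or_mem hNF).resolve_left hNP) hNP ?_
    rw [mul_comm]
    exact Ideal.mul_mono_right hJP (hJ ▸ Ideal.mem_span_singleton_self α)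

/-! ### Contraction and extension between O and O_K. -/

section Quadratic

variable {K : Type*} [Field K] {f : ℕ}

theorem orderInclusion_injective : Function.Injective (orderInclusion K f) := fun _ _ h =>
  Subtype.ext (congrArg (fun t : 𝓞 K => (t : K)) h)

theorem coe_orderInclusion (x : order K f) : ((orderInclusion K f x : 𝓞 K) : K) = x := rfl

theorem exists_orderInclusion_eq (y : 𝓞 K) : ∃ z : order K f, orderInclusion K f z = f * y :=
  ⟨⟨f * y, 0, y, by simp⟩, RingOfIntegers.ext (by simp [coe_orderInclusion])⟩

theorem exists_eq_int_add (x : order K f) : ∃ (a : ℤ) (z : order K f) (y : 𝓞 K),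
    x = a + z ∧ orderInclusion K f z = f * y := by
  obtain ⟨x, n, y, rfl⟩ := x
  obtain ⟨z, hz⟩ := exists_orderInclusion_eq (f := f) y
  refine ⟨n, z, y, orderInclusion_injective ?_, hz⟩
  rw [map_add, hz, map_intCast]
  exact RingOfIntegers.ext (by simp [coe_orderInclusion])

/-- If `x ∈ 𝓞` is congruent to `1` modulo `n 𝓞_K`, where `f ∣ n`, then `x` is a unit modulo
`n 𝓞`. -/
theorem exists_mul_sub_one_mem {n : ℕ} (hn : f ∣ n) {x : order K f}
    (hx : orderInclusion K f x - 1 ∈ Ideal.span {(n : 𝓞 K)}) :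
    ∃ w : order K f, w * x - 1 ∈ Ideal.span {(n : order K f)} := by
  obtain ⟨k, rfl⟩ := hn
  obtain ⟨y, hy⟩ := Ideal.mem_span_singleton'.1 hx
  obtain ⟨z, hz⟩ := exists_orderInclusion_eq (f := f) ((k : 𝓞 K) * y)
  obtain ⟨w, hw⟩ := exists_orderInclusion_eq (f := f) (y * ((k : 𝓞 K) * y))
  -- Here x = 1 + z with z = n y in O, but z need not lie in n O. Its square does: z² = n · (f k y²)
  -- with f k y² ∈ O. So 1 - z inverts x modulo n O.
  refine ⟨1 - z, Ideal.mem_span_singleton'.2 ⟨-w, orderInclusion_injective ?_⟩⟩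
  have hx' : orderInclusion K f x = 1 + f * k * y := by
    push_cast at hy; linear_combination -hy
  simp only [map_mul, map_neg, map_sub, map_one, map_natCast, hz, hw, hx', Nat.cast_mul]
  ring

/-- Ideals of `𝓞_K` prime to a multiple of the conductor have contractions prime to it. -/
theorem isPrimeTo_contraction {n : ℕ} (hn : f ∣ n) {a : Ideal (𝓞 K)} (ha : IsPrimeTo n a) :
    IsPrimeTo n (contraction f a) := by
  obtain ⟨x, hx, hxn⟩ := isPrimeTo_iff.1 ha
  obtain ⟨y, hy⟩ := Ideal.mem_span_singleton'.1 hxn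
  obtain ⟨k, rfl⟩ := hn
  obtain ⟨z, hz⟩ := exists_orderInclusion_eq (f := f) ((k : 𝓞 K) * y)
  have hx' : orderInclusion K f (1 + z) = x := by
    rw [map_add, hz, map_one]; push_cast at hy; linear_combination hy
  -- The element x = 1 + n y already lies in O, but is 1 only modulo n O_K; multiplying by w makes
  -- it 1 modulo n O.
  obtain ⟨w, hw⟩ := exists_mul_sub_one_mem (dvd_mul_right f k) (x := 1 + z) (by rwa [hx'])
  refine isPrimeTo_iff.2 ⟨_, Ideal.mul_mem_left _ w ?_, hw⟩
  rw [contraction, Ideal.mem_comap, hx']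
  exact hx

theorem IsPrimeTo.map {R S : Type*} [CommRing R] [CommRing S] (φ : R →+* S) {n : ℕ} {I : Ideal R}
    (hI : IsPrimeTo n I) : IsPrimeTo n (I.map φ) := by
  obtain ⟨x, hx, hxn⟩ := isPrimeTo_iff.1 hI
  refine isPrimeTo_iff.2 ⟨φ x, Ideal.mem_map_of_mem φ hx, ?_⟩
  have := Ideal.mem_map_of_mem φ hxn
  rwa [Ideal.map_span, Set.image_singleton, map_sub, map_one, map_natCast] at this

/-- Choose e ∈ a ∩ O with e - 1 = d f, d ∈ O. For t ∈ a, t = t e - d (f t), and both e and f t lie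
in a ∩ O. -/
theorem map_contraction {a : Ideal (𝓞 K)} (ha : IsPrimeTo f a) :
    (contraction f a).map (orderInclusion K f) = a := by
  refine le_antisymm Ideal.map_comap_le fun t ht => ?_
  obtain ⟨e, he, hef⟩ := isPrimeTo_iff.1 (isPrimeTo_contraction dvd_rfl ha)
  obtain ⟨d, hd⟩ := Ideal.mem_span_singleton'.1 hef
  obtain ⟨s, hs⟩ := exists_orderInclusion_eq (f := f) t
  have hsa : s ∈ contraction f a := by
    rw [contraction, Ideal.mem_comap, hs]
    exact a.mul_mem_left _ ht
  have h : t = t * orderInclusion K f e - orderInclusion K f d * orderInclusion K f s := by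
    have := congrArg (orderInclusion K f) hd
    simp only [map_mul, map_sub, map_natCast, map_one] at this
    rw [hs]
    linear_combination t * this
  rw [h]
  exact sub_mem (Ideal.mul_mem_left _ _ (Ideal.mem_map_of_mem _ he))
    (Ideal.mul_mem_left _ _ (Ideal.mem_map_of_mem _ hsa))

/-- Since f O_K ⊆ O, f · A O_K ⊆ A. With e ∈ A and e - 1 = d f, any x ∈ A O_K ∩ O equals x e - d (f
x), which lies in A. -/
theorem contraction_map {A : Ideal (order K f)} (hA : IsPrimeTo f A) :
    contraction f (A.map (orderInclusion K f)) = A := by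
  refine le_antisymm (fun x hx => ?_) Ideal.le_comap_map
  -- The extra factor r makes the claim stable under multiplication of t by O_K, as the span
  -- induction requires.
  have key : ∀ t ∈ A.map (orderInclusion K f), ∀ r : 𝓞 K,
      ∃ s ∈ A, orderInclusion K f s = f * (r * t) := by
    intro t ht
    refine Submodule.span_induction
      (p := fun t _ => ∀ r : 𝓞 K, ∃ s ∈ A, orderInclusion K f s = f * (r * t))
      ?_ (fun r => ⟨0, A.zero_mem, by simp⟩) ?_ ?_ ht
    · rintro _ ⟨s, hs, rfl⟩ r
      obtain ⟨z, hz⟩ := exists_orderInclusion_eq (f := f) r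
      exact ⟨z * s, A.mul_mem_left _ hs, by rw [map_mul, hz, mul_assoc]⟩
    · intro _ _ _ _ h h' r
      obtain ⟨s, hs, h⟩ := h r
      obtain ⟨s', hs', h'⟩ := h' r
      exact ⟨s + s', add_mem hs hs', by rw [map_add, h, h']; ring⟩
    · intro c t _ h r
      obtain ⟨s, hs, h⟩ := h (r * c)
      exact ⟨s, hs, by rw [h, smul_eq_mul, mul_assoc]⟩
  obtain ⟨e, he, hef⟩ := isPrimeTo_iff.1 hA
  obtain ⟨d, hd⟩ := Ideal.mem_span_singleton'.1 hef
  obtain ⟨s, hs, hsx⟩ := key _ hx 1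
  have hs' : s = f * x := orderInclusion_injective (by rw [hsx, map_mul, map_natCast, one_mul])
  have h : x = x * e - d * s := by
    rw [hs']
    linear_combination x * hd
  rw [h]
  exact sub_mem (A.mul_mem_left _ he) (A.mul_mem_left _ hs)

variable [NumberField K]

instance isFractionRing_order [NeZero f] : IsFractionRing (order K f) K := by
  have hf : (f : K) ≠ 0 := by exact_mod_cast NeZero.ne f
  refine IsFractionRing.of_field (order K f) K fun z => ?_
  obtain ⟨x, y, hy, rfl⟩ := IsFractionRing.div_surjective (A := 𝓞 K) z
  obtain ⟨s, hs⟩ := exists_orderInclusion_eq (f := f) x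
  obtain ⟨t, ht⟩ := exists_orderInclusion_eq (f := f) y
  refine ⟨s, t, ?_⟩
  have hs' : (s : K) = f * x := by
    simpa [coe_orderInclusion] using congrArg (fun t : 𝓞 K => (t : K)) hs
  have ht' : (t : K) = f * y := by
    simpa [coe_orderInclusion] using congrArg (fun t : 𝓞 K => (t : K)) ht
  change _ = (s : K) / (t : K)
  rw [hs', ht', mul_div_mul_left _ _ hf]

/-- O / n O is finite, and an ideal containing n is determined by its image there. -/
theorem finite_setOf_natCast_mem {n : ℕ} (hn : n ≠ 0) :
    {P : Ideal (order K f) | P.IsMaximal ∧ (n : order K f) ∈ P}.Finite := by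
  have hinj : Function.Injective (orderInclusion K f).toIntAlgHom.toLinearMap :=
    orderInclusion_injective
  have : Module.Finite ℤ (order K f) := Module.Finite.of_injective _ hinj
  have : Module.Free ℤ (order K f) := Module.free_of_finite_type_torsion_free'
  have : Finite (order K f ⧸ Ideal.span {(n : order K f)}) :=
    Ideal.finiteQuotientOfFreeOfNeBot _ (by simpa using hn)
  refine Set.Finite.of_finite_image
    (f := fun P : Ideal (order K f) => Ideal.Quotient.mk (Ideal.span {(n : order K f)}) '' P)
    (Set.toFinite _) ?_
  have key : ∀ P Q : Ideal (order K f), (n : order K f) ∈ Q →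
      Ideal.Quotient.mk (Ideal.span {(n : order K f)}) '' P =
        Ideal.Quotient.mk (Ideal.span {(n : order K f)}) '' Q → P ≤ Q := by
    intro P Q hQ h x hx
    obtain ⟨y, hy, hxy⟩ := h ▸ Set.mem_image_of_mem _ hx
    have := (Ideal.span_singleton_le_iff_mem _).2 hQ (Ideal.Quotient.eq.1 hxy)
    simpa using sub_mem hy this
  exact fun P hP Q hQ h => le_antisymm (key P Q hQ.2 h) (key Q P hP.2 h.symm)

end Quadratic

/-! ### Extension as an isomorphism of ideal groups. -/

section Quadratic

variable {K : Type*} [Field K] {f : ℕ}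

theorem nonZeroDivisors_le_comap_orderInclusion :
    (order K f)⁰ ≤ Submonoid.comap (orderInclusion K f) (𝓞 K)⁰ := fun _ hx =>
  mem_nonZeroDivisors_of_ne_zero
    ((map_ne_zero_iff _ orderInclusion_injective).2 (nonZeroDivisors.ne_zero hx))

variable [NumberField K]

variable (K f) in
/-- The extension `J ↦ J 𝓞_K` of invertible fractional ideals. -/
noncomputable def extension [NeZero f] :
    (FractionalIdeal (order K f)⁰ K)ˣ →* (FractionalIdeal (𝓞 K)⁰ K)ˣ :=
  Units.map (FractionalIdeal.extendedHom' (K := K) K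
    (nonZeroDivisors_le_comap_orderInclusion (K := K) (f := f))).toMonoidHom

variable [NeZero f]

theorem coe_extension {u : (FractionalIdeal (order K f)⁰ K)ˣ} {I : Ideal (order K f)}
    (hu : (u : FractionalIdeal (order K f)⁰ K) = I) :
    (extension K f u : FractionalIdeal (𝓞 K)⁰ K) = (I.map (orderInclusion K f) : Ideal (𝓞 K)) := by
  change FractionalIdeal.extended K nonZeroDivisors_le_comap_orderInclusion
    (u : FractionalIdeal (order K f)⁰ K) = _
  rw [hu, FractionalIdeal.extended_coeIdeal_eq_map]

/-- Take a nonzero x ∈ a ∩ O with x ≡ 1 modulo f. In the Dedekind domain O_K, x O_K = a b, with b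
again prime to f. Then (a ∩ O)(b ∩ O) = x O, because both sides are prime to f and have the same
extension; so a ∩ O divides an invertible ideal. -/
theorem exists_unit_contraction {n : ℕ} (hn : f ∣ n) {a : Ideal (𝓞 K)} (ha : IsPrimeTo n a)
    (ha0 : a ≠ ⊥) : ∃ u : (FractionalIdeal (order K f)⁰ K)ˣ,
      (u : FractionalIdeal (order K f)⁰ K) = contraction f a := by
  have haf := ha.of_dvd hn
  have hc0 : contraction f a ≠ ⊥ := fun h => ha0 (by rw [← map_contraction haf, h, Ideal.map_bot])
  obtain ⟨x, hx, hx0, hxf⟩ := (isPrimeTo_contraction dvd_rfl haf).exists_ne_zero hc0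
  have hx' : IsPrimeTo f (Ideal.span {x}) :=
    isPrimeTo_iff.2 ⟨x, Ideal.mem_span_singleton_self x, hxf⟩
  obtain ⟨b, hb⟩ := Ideal.dvd_span_singleton.2 (show orderInclusion K f x ∈ a from hx)
  have hspan : Ideal.span {orderInclusion K f x} = (Ideal.span {x}).map (orderInclusion K f) := by
    rw [Ideal.map_span, Set.image_singleton]
  have hbf : IsPrimeTo f b := (hx'.map (orderInclusion K f)).mono
    (by rw [← hspan, hb]; exact Ideal.mul_le_right)
  refine exists_unit_of_mul_eq_span (J := contraction f b) (x := x) ?_ hx0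
  rw [← contraction_map
    ((isPrimeTo_contraction dvd_rfl haf).mul (isPrimeTo_contraction dvd_rfl hbf)),
    Ideal.map_mul, map_contraction haf, map_contraction hbf, ← hb, hspan, contraction_map hx']

theorem extension_mem_idealGroup {n : ℕ} {u : (FractionalIdeal (order K f)⁰ K)ˣ}
    (hu : u ∈ idealGroup (order K f) K n) : extension K f u ∈ idealGroup (𝓞 K) K n := by
  obtain ⟨I, J, U, V, hI, hJ, hU, hV, rfl⟩ := exists_mul_inv_of_mem_idealGroup hu
  rw [map_mul, map_inv]
  exact mul_mem (mem_idealGroup (coe_extension hU) (hI.map _))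
    (inv_mem (mem_idealGroup (coe_extension hV) (hJ.map _)))

/-- A quotient of ideals I, J prime to n is in the kernel only if I O_K = J O_K, and contracting
gives I = J. -/
theorem extension_injOn {n : ℕ} (hn : f ∣ n) :
    Set.InjOn (extension K f) (idealGroup (order K f) K n) := by
  have key : ∀ u ∈ idealGroup (order K f) K n, extension K f u = 1 → u = 1 := by
    intro u hu h
    obtain ⟨I, J, U, V, hI, hJ, hU, hV, rfl⟩ := exists_mul_inv_of_mem_idealGroup hu
    rw [map_mul, map_inv, mul_inv_eq_one] at h
    have h' := congrArg (Units.val) h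
    rw [coe_extension hU, coe_extension hV] at h'
    have h'' := FractionalIdeal.coeIdeal_injective (K := K) h'
    rw [mul_inv_eq_one]
    ext1
    rw [hU, hV, ← contraction_map (hI.of_dvd hn), h'', contraction_map (hJ.of_dvd hn)]
  intro u hu v hv h
  rw [← mul_inv_eq_one]
  exact key _ (mul_mem hu (inv_mem hv)) (by rw [map_mul, map_inv, h, mul_inv_cancel])

theorem exists_extension_eq {n : ℕ} (hn : f ∣ n) {a : Ideal (𝓞 K)} (ha : IsPrimeTo n a)
    {A : (FractionalIdeal (𝓞 K)⁰ K)ˣ} (hA : (A : FractionalIdeal (𝓞 K)⁰ K) = a) :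
    ∃ u ∈ idealGroup (order K f) K n, (u : FractionalIdeal (order K f)⁰ K) = contraction f a ∧
      extension K f u = A := by
  obtain ⟨u, hu⟩ := exists_unit_contraction hn ha (coe_ne_bot hA)
  refine ⟨u, mem_idealGroup hu (isPrimeTo_contraction hn ha), hu, Units.ext ?_⟩
  rw [coe_extension hu, map_contraction (ha.of_dvd hn), hA]

theorem exists_extension_eq_of_mem_idealGroup {n : ℕ} (hn : f ∣ n)
    {v : (FractionalIdeal (𝓞 K)⁰ K)ˣ} (hv : v ∈ idealGroup (𝓞 K) K n) :
    ∃ u ∈ idealGroup (order K f) K n, extension K f u = v := by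
  obtain ⟨a, b, A, B, ha, hb, hA, hB, rfl⟩ := exists_mul_inv_of_mem_idealGroup hv
  obtain ⟨U, hU, -, hUA⟩ := exists_extension_eq hn ha hA
  obtain ⟨V, hV, -, hVB⟩ := exists_extension_eq hn hb hB
  exact ⟨U * V⁻¹, mul_mem hU (inv_mem hV), by rw [map_mul, map_inv, hUA, hVB]⟩

/-! ### Comparison of the principal subgroups. -/

/-- The gcd of a and n becomes a unit in O_K, and an integer that is a unit in O_K is ±1. -/
theorem isCoprime_of_mul_add_mul_eq_one {a n : ℤ} {x y : 𝓞 K} (h : a * x + n * y = 1) :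
    IsCoprime a n := by
  rw [Int.isCoprime_iff_gcd_eq_one]
  obtain ⟨k, hk⟩ := Int.gcd_dvd_left a n
  obtain ⟨l, hl⟩ := Int.gcd_dvd_right a n
  have hk' := congrArg (Int.cast : ℤ → 𝓞 K) hk
  have hl' := congrArg (Int.cast : ℤ → 𝓞 K) hl
  push_cast at hk' hl'
  have h1 : IsUnit (algebraMap ℤ (𝓞 K) (Int.gcd a n : ℤ)) := by
    refine IsUnit.of_mul_eq_one (k * x + l * y) ?_
    rw [eq_intCast, Int.cast_natCast]
    linear_combination h - x * hk' - y * hl'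
  have h2 := (isUnit_map_iff (algebraMap ℤ (𝓞 K)) _).1 h1
  simpa using Int.isUnit_iff_natAbs_eq.1 h2

/-- A generator α = a + N f y equals a + N z with z = f y ∈ O, so it already lies in O and is a
modulo N O. -/
theorem principalGroup_le_map (N : ℕ) :
    principalGroup (𝓞 K) K (N * f) ≤
      (principalGroup (order K f) K N ⊓ idealGroup (order K f) K (N * f)).map (extension K f) := by
  refine (Subgroup.closure_le _).2 ?_
  rintro u ⟨α, a, ha, hα, hu⟩
  obtain ⟨y, hy⟩ := Ideal.mem_span_singleton'.1 hα
  obtain ⟨z, hz⟩ := exists_orderInclusion_eq (f := f) y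
  have hβ : orderInclusion K f (a + N * z) = α := by
    simp only [map_add, map_mul, map_intCast, map_natCast, hz]
    push_cast at hy
    linear_combination hy
  have hα0 : a + N * z ≠ 0 := by
    intro h
    refine coe_ne_bot hu ?_
    rw [← hβ, h, map_zero, Ideal.span_singleton_eq_bot]
  obtain ⟨v, hv⟩ := exists_unit_span K hα0
  have hva : a + N * z - (a : order K f) ∈ Ideal.span {(N : order K f)} :=
    Ideal.mem_span_singleton'.2 ⟨z, by ring⟩
  refine ⟨v, ⟨Subgroup.subset_closure ⟨a + N * z, a, ?_, hva, hv⟩, mem_idealGroup hv ?_⟩,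
    Units.ext ?_⟩
  · push_cast at ha
    exact ha.of_mul_right_left
  · obtain ⟨s, t, hst⟩ := ha
    have hst' := congrArg (Int.cast : ℤ → 𝓞 K) hst
    push_cast at hst' hy
    -- With s a ≡ 1 modulo Nf, s α is 1 modulo Nf O_K, hence a unit modulo Nf O: the ideal α O is
    -- prime to Nf.
    obtain ⟨w, hw⟩ := exists_mul_sub_one_mem (K := K) (dvd_mul_left f N)
      (x := s * (a + N * z)) (Ideal.mem_span_singleton'.2 ⟨s * y - t, by
        rw [map_mul, map_intCast, hβ]
        push_cast
        linear_combination (s : 𝓞 K) * hy - hst'⟩)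
    exact isPrimeTo_iff.2 ⟨_, Ideal.mul_mem_left _ w
      (Ideal.mul_mem_left _ _ (Ideal.mem_span_singleton_self _)), hw⟩
  · rw [coe_extension hv, Ideal.map_span, Set.image_singleton, hβ, hu]

/-- Write γ = c + N (b + f y): modulo Nf O_K it is the integer c + N b. This integer is prime to Nf
because γ is a unit modulo Nf, so c itself need not be assumed prime to N. -/
theorem extension_span_mem_principalGroup {N : ℕ} {γ : order K f} {c : ℤ}
    (hγ : γ - c ∈ Ideal.span {(N : order K f)}) (hprime : IsPrimeTo (N * f) (Ideal.span {γ}))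
    {u : (FractionalIdeal (order K f)⁰ K)ˣ}
    (hu : (u : FractionalIdeal (order K f)⁰ K) = (Ideal.span {γ} : Ideal (order K f))) :
    extension K f u ∈ principalGroup (𝓞 K) K (N * f) := by
  obtain ⟨x, hx⟩ := Ideal.mem_span_singleton'.1 hγ
  obtain ⟨b, z, y, rfl, hz⟩ := exists_eq_int_add x
  have hx' := congrArg (orderInclusion K f) hx
  simp only [map_mul, map_add, map_sub, map_natCast, map_intCast, hz] at hx'
  obtain ⟨e, he, heN⟩ := isPrimeTo_iff.1 hprime
  obtain ⟨s, rfl⟩ := Ideal.mem_span_singleton'.1 he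
  obtain ⟨t, ht⟩ := Ideal.mem_span_singleton'.1 heN
  have ht' := congrArg (orderInclusion K f) ht
  simp only [map_mul, map_sub, map_natCast, map_one] at ht'
  refine Subgroup.subset_closure ⟨orderInclusion K f γ, c + N * b, ?_,
    Ideal.mem_span_singleton'.2 ⟨y, ?_⟩, ?_⟩
  · refine isCoprime_of_mul_add_mul_eq_one (K := K) (x := orderInclusion K f s)
      (y := y * orderInclusion K f s - orderInclusion K f t) ?_
    push_cast at ht' ⊢
    linear_combination orderInclusion K f s * hx' - ht'
  · push_cast
    linear_combination hx'
  · rw [coe_extension hu, Ideal.map_span, Set.image_singleton]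

/-- From left to right, lift along `principalGroup_le_map` and use injectivity. Conversely, u = I
J⁻¹ = α β⁻¹, where α and β need not be prime to f. They are replaced by γ and x prime to Nf: with x
∈ J, x ≡ 1 modulo Nf and x O = J C, one has u = (I C)(x O)⁻¹ and I C = (α x / β) O = γ O. -/
theorem extension_mem_principalGroup_iff {N : ℕ} {u : (FractionalIdeal (order K f)⁰ K)ˣ}
    (hu : u ∈ idealGroup (order K f) K (N * f)) :
    extension K f u ∈ principalGroup (𝓞 K) K (N * f) ↔ u ∈ principalGroup (order K f) K N := by
  constructor
  · intro h
    obtain ⟨v, ⟨hv, hv'⟩, h⟩ := principalGroup_le_map N h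
    exact extension_injOn (dvd_mul_left f N) hv' hu h ▸ hv
  · intro h
    obtain ⟨I, J, U, V, hI, hJ, hU, hV, rfl⟩ := exists_mul_inv_of_mem_idealGroup hu
    obtain ⟨α, β, a, b, A, B, hb, hα, hβ, hA, hB, hUV⟩ := exists_mul_inv_of_mem_principalGroup h
    obtain ⟨x, hxJ, hx0, hx⟩ := hJ.exists_ne_zero (coe_ne_bot hV)
    obtain ⟨C, hC⟩ := exists_mul_eq_span hV hxJ
    obtain ⟨X, hX⟩ := exists_unit_span K hx0
    have hxC : IsPrimeTo (N * f) C := isPrimeTo_iff.2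
      ⟨x, Ideal.mul_le_right (hC ▸ Ideal.mem_span_singleton_self x), hx⟩
    have hxN : x - ((1 : ℤ) : order K f) ∈ Ideal.span {(N : order K f)} := by
      rw [Int.cast_one]
      exact Ideal.span_singleton_le_span_singleton.2
        (by exact_mod_cast Nat.cast_dvd_cast (dvd_mul_right N f)) hx
    obtain ⟨Y, hY⟩ := exists_unit_of_mul_eq_span (K := K) ((mul_comm C J).trans hC) hx0
    have hVY : V * Y = X := by
      ext1
      rw [Units.val_mul, hV, hY, hX, ← hC, FractionalIdeal.coeIdeal_mul]
    have hUY : ((U * Y : (FractionalIdeal (order K f)⁰ K)ˣ) : FractionalIdeal (order K f)⁰ K) =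
        (I * C : Ideal (order K f)) := by
      rw [Units.val_mul, hU, hY, FractionalIdeal.coeIdeal_mul]
    have hmul : U * Y * B = A * X := by
      rw [← hVY, mul_inv_eq_iff_eq_mul.1 hUV]
      rw [show A * B⁻¹ * V * Y * B = A * (V * Y) * (B⁻¹ * B) by
        simp only [mul_assoc, mul_left_comm, mul_comm], inv_mul_cancel, mul_one]
    have hideal : I * C * Ideal.span {β} = Ideal.span {α * x} := by
      have h := congrArg Units.val hmul
      rw [Units.val_mul, Units.val_mul A, hUY, hB, hA, hX, ← FractionalIdeal.coeIdeal_mul,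
        ← FractionalIdeal.coeIdeal_mul, Ideal.span_singleton_mul_span_singleton] at h
      exact FractionalIdeal.coeIdeal_injective (K := K) h
    -- I C β = α x O shows that β divides α x in O.
    obtain ⟨γ, hγ, hγβ⟩ := Ideal.mem_mul_span_singleton.1
      (hideal ▸ Ideal.mem_span_singleton_self (α * x))
    have hγI : I * C = Ideal.span {γ} := by
      refine FractionalIdeal.coeIdeal_injective (K := K) (B.mul_left_inj.1 ?_)
      change ((I * C : Ideal (order K f)) : FractionalIdeal (order K f)⁰ K) *
          (B : FractionalIdeal (order K f)⁰ K) =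
        (Ideal.span {γ} : Ideal (order K f)) * (B : FractionalIdeal (order K f)⁰ K)
      rw [hB, ← FractionalIdeal.coeIdeal_mul, ← FractionalIdeal.coeIdeal_mul, hideal,
        Ideal.span_singleton_mul_span_singleton, hγβ]
    obtain ⟨s, t, hst⟩ := hb
    have hst' := congrArg (Int.cast : ℤ → order K f) hst
    push_cast at hst'
    -- From γ β = α x with α ≡ a, β ≡ b, x ≡ 1 and s b ≡ 1 modulo N.
    have hγN : γ - ((s * a : ℤ) : order K f) ∈ Ideal.span {(N : order K f)} := by
      have : γ - ((s * a : ℤ) : order K f) =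
          s * x * (α - a) + s * a * (x - ((1 : ℤ) : order K f)) - s * γ * (β - b) + t * γ * N := by
        push_cast
        linear_combination (-γ) * hst' + (s : order K f) * hγβ
      rw [this]
      exact add_mem (sub_mem (add_mem (Ideal.mul_mem_left _ _ hα) (Ideal.mul_mem_left _ _ hxN))
        (Ideal.mul_mem_left _ _ hβ)) (Ideal.mul_mem_left _ _ (Ideal.mem_span_singleton_self _))
    have hX' := extension_span_mem_principalGroup hxN
      (isPrimeTo_iff.2 ⟨x, Ideal.mem_span_singleton_self x, hx⟩) hX
    have hUY' := extension_span_mem_principalGroup hγN (hγI ▸ hI.mul hxC) (hγI ▸ hUY)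
    have : U * V⁻¹ = (U * Y) * X⁻¹ := by
      rw [← hVY, mul_inv, mul_comm V⁻¹, mul_assoc, mul_inv_cancel_left]
    rw [this, map_mul, map_inv]
    exact mul_mem hUY' (inv_mem hX')

/-! ### Generation of I(O, N), and passage to the quotients. -/

/-- An ideal I prime to N has a multiple I J = α O with α ≡ 1 modulo N and J prime to Nf, so I is
J⁻¹ times an element of P₀(O, N). -/
theorem idealGroup_le_sup {N : ℕ} (hN : 0 < N) :
    idealGroup (order K f) K N ≤
      idealGroup (order K f) K (N * f) ⊔ principalGroup (order K f) K N := by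
  refine (Subgroup.closure_le _).2 ?_
  rintro u ⟨I, hu, -, hI⟩
  obtain ⟨α, J, hα0, hα, hIJ, hJ⟩ := exists_mul_eq_span_isPrimeTo hN (NeZero.pos f)
    (finite_setOf_natCast_mem (NeZero.ne f)) hu hI
  obtain ⟨V, hV⟩ := exists_unit_of_mul_eq_span (K := K) ((mul_comm J I).trans hIJ) hα0
  have hmul : ((u * V : (FractionalIdeal (order K f)⁰ K)ˣ) : FractionalIdeal (order K f)⁰ K) =
      (Ideal.span {α} : Ideal (order K f)) := by
    rw [Units.val_mul, hu, hV, ← FractionalIdeal.coeIdeal_mul, hIJ]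
  rw [← inv_mul_cancel_left V u, mul_comm V u]
  exact Subgroup.mul_mem_sup (inv_mem (mem_idealGroup hV hJ))
    (Subgroup.subset_closure ⟨α, 1, isCoprime_one_left, by simpa using hα, hmul⟩)

end Quadratic

theorem idealGroup_anti {R K : Type*} [CommRing R] [Field K] [Algebra R K] {m n : ℕ} (h : m ∣ n) :
    idealGroup R K n ≤ idealGroup R K m :=
  Subgroup.closure_mono fun _ ⟨I, hu, hI, hn⟩ => ⟨I, hu, hI, hn.of_dvd h⟩

/-- A homomorphism `φ` that maps a subgroup `H ≤ H'` isomorphically onto `I` and reflects the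
membership in `P` induces an isomorphism `I ⧸ P ≃ H' ⧸ P'` if `H` and `P'` generate `H'`. -/
theorem exists_quotient_mulEquiv {G G' : Type*} [CommGroup G] [CommGroup G'] (φ : G' →* G)
    {H H' P' : Subgroup G'} {I P : Subgroup G} (hle : H ≤ H') (hmem : ∀ u ∈ H, φ u ∈ I)
    (hinj : Set.InjOn φ H) (hsurj : ∀ v ∈ I, ∃ u ∈ H, φ u = v)
    (hiff : ∀ u ∈ H, φ u ∈ P ↔ u ∈ P') (hsup : H' ≤ H ⊔ P') :
    ∃ Ψ : I ⧸ P.subgroupOf I ≃* H' ⧸ P'.subgroupOf H', ∀ (u : G') (hu : u ∈ H),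
      Ψ (QuotientGroup.mk ⟨φ u, hmem u hu⟩) = QuotientGroup.mk ⟨u, hle hu⟩ := by
  let e : H ≃* I := MulEquiv.ofBijective
    ((φ.comp H.subtype).codRestrict I fun u => hmem u u.2)
    ⟨fun u v h => Subtype.ext (hinj u.2 v.2 (congrArg Subtype.val h)), fun ⟨v, hv⟩ => by
      obtain ⟨u, hu, rfl⟩ := hsurj v hv
      exact ⟨⟨u, hu⟩, rfl⟩⟩
  let ψ : I →* H' ⧸ P'.subgroupOf H' :=
    (QuotientGroup.mk' _).comp ((Subgroup.inclusion hle).comp e.symm.toMonoidHom)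
  have hψ : ∀ (u : G') (hu : u ∈ H),
      ψ ⟨φ u, hmem u hu⟩ = QuotientGroup.mk ⟨u, hle hu⟩ := fun u hu => by
    have h : e.symm ⟨φ u, hmem u hu⟩ = ⟨u, hu⟩ := e.symm_apply_eq.2 rfl
    change QuotientGroup.mk (Subgroup.inclusion hle (e.symm ⟨φ u, hmem u hu⟩)) = _
    rw [h]
    rfl
  -- Surjectivity is where H and P' generating H' enters: the P' component dies in the quotient.
  have hψs : Function.Surjective ψ := by
    intro c
    obtain ⟨⟨v, hv⟩, rfl⟩ := QuotientGroup.mk_surjective c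
    obtain ⟨u, hu, p, hp, rfl⟩ := Subgroup.mem_sup.1 (hsup hv)
    refine ⟨⟨φ u, hmem u hu⟩, ?_⟩
    rw [hψ u hu, QuotientGroup.eq, Subgroup.mem_subgroupOf]
    change u⁻¹ * (u * p) ∈ _
    rwa [inv_mul_cancel_left]
  have hker : P.subgroupOf I = ψ.ker := by
    ext ⟨v, hv⟩
    obtain ⟨u, hu, rfl⟩ := hsurj v hv
    rw [MonoidHom.mem_ker, hψ u hu, QuotientGroup.eq_one_iff, Subgroup.mem_subgroupOf,
      Subgroup.mem_subgroupOf]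
    exact hiff u hu
  exact ⟨QuotientGroup.liftEquiv _ hψs hker, hψ⟩

end OrderClassGroup

open OrderClassGroup NumberField nonZeroDivisors in
theorem mainTheorem3 {K : Type*} [Field K] [NumberField K] [NumberField.IsTotallyComplex K]
    (hK : Module.finrank ℚ K = 2) (f N : ℕ) (hf : 0 < f) (hN : 0 < N) :
    (∀ u : idealGroup (𝓞 K) K (N * f), ∃ (a b : Ideal (𝓞 K)) (A B : idealGroup (𝓞 K) K (N * f)),
      IsPrimeTo (N * f) a ∧ IsPrimeTo (N * f) b ∧
      ((A : (FractionalIdeal (𝓞 K)⁰ K)ˣ) : FractionalIdeal (𝓞 K)⁰ K) = a ∧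
      ((B : (FractionalIdeal (𝓞 K)⁰ K)ˣ) : FractionalIdeal (𝓞 K)⁰ K) = b ∧
      u = A * B⁻¹) ∧
    ∃ Ψ : ClassGroup₀ (𝓞 K) K (N * f) ≃* ClassGroup₀ (order K f) K N,
      ∀ a b : Ideal (𝓞 K), a ≠ ⊥ → b ≠ ⊥ → IsPrimeTo (N * f) a → IsPrimeTo (N * f) b →
        ∃ (A B : idealGroup (𝓞 K) K (N * f)) (A' B' : idealGroup (order K f) K N),
          ((A : (FractionalIdeal (𝓞 K)⁰ K)ˣ) : FractionalIdeal (𝓞 K)⁰ K) = a ∧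
          ((B : (FractionalIdeal (𝓞 K)⁰ K)ˣ) : FractionalIdeal (𝓞 K)⁰ K) = b ∧
          ((A' : (FractionalIdeal (order K f)⁰ K)ˣ) : FractionalIdeal (order K f)⁰ K) =
            contraction f a ∧
          ((B' : (FractionalIdeal (order K f)⁰ K)ˣ) : FractionalIdeal (order K f)⁰ K) =
            contraction f b ∧
          Ψ (QuotientGroup.mk (A * B⁻¹)) = QuotientGroup.mk (A' * B'⁻¹) ∧
          (((A' * B'⁻¹ : idealGroup (order K f) K N) : (FractionalIdeal (order K f)⁰ K)ˣ) ∈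
              principalGroup (order K f) K N ↔
            ((A * B⁻¹ : idealGroup (𝓞 K) K (N * f)) : (FractionalIdeal (𝓞 K)⁰ K)ˣ) ∈
              principalGroup (𝓞 K) K (N * f)) := by

  have : NeZero f := ⟨hf.ne'⟩
  have hdvd : f ∣ N * f := dvd_mul_left f N
  have hle := idealGroup_anti (R := order K f) (K := K) (dvd_mul_right N f)
  obtain ⟨Ψ, hΨ⟩ := exists_quotient_mulEquiv (extension K f) hle
    (fun _ hu => extension_mem_idealGroup hu) (extension_injOn hdvd)
    (fun _ hv => exists_extension_eq_of_mem_idealGroup hdvd hv)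
    (fun _ hu => extension_mem_principalGroup_iff hu) (idealGroup_le_sup hN)
  refine ⟨fun u => ?_, Ψ, fun a b ha0 hb0 ha hb => ?_⟩
  · obtain ⟨a, b, A, B, ha, hb, hA, hB, h⟩ := exists_mul_inv_of_mem_idealGroup u.2
    exact ⟨a, b, ⟨A, mem_idealGroup hA ha⟩, ⟨B, mem_idealGroup hB hb⟩, ha, hb, hA, hB,
      Subtype.ext h⟩
  · have unit_of_ne : ∀ c : Ideal (𝓞 K), c ≠ ⊥ →
        ∃ C : (FractionalIdeal (𝓞 K)⁰ K)ˣ, (C : FractionalIdeal (𝓞 K)⁰ K) = c := fun c hc =>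
      ⟨Units.mk0 c (FractionalIdeal.coeIdeal_ne_zero.2 hc), rfl⟩
    obtain ⟨A, hA⟩ := unit_of_ne a ha0
    obtain ⟨B, hB⟩ := unit_of_ne b hb0
    -- The given ideal is rewritten as the extension of its contraction, the form in which Ψ is
    -- known.
    obtain ⟨U, hU, hUa, rfl⟩ := exists_extension_eq hdvd ha hA
    obtain ⟨V, hV, hVb, rfl⟩ := exists_extension_eq hdvd hb hB
    have hmem := mul_mem hU (inv_mem hV)
    refine ⟨⟨_, mem_idealGroup hA ha⟩, ⟨_, mem_idealGroup hB hb⟩, ⟨U, hle hU⟩, ⟨V, hle hV⟩,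
      hA, hB, hUa, hVb, ?_, ?_⟩
    · rw [QuotientGroup.mk_mul, QuotientGroup.mk_inv, map_mul, map_inv, hΨ U hU, hΨ V hV]
      rfl
    · change U * V⁻¹ ∈ _ ↔ extension K f U * (extension K f V)⁻¹ ∈ _
      rw [← map_inv, ← map_mul, extension_mem_principalGroup_iff hmem]
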